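/- For an $\mathbb{R}^3$-valued function $f(s,t)$ of two real variables write $f_s=\partial_s f$, $f_t=\partial_t f$; for $\vec p\in\mathbb{R}^3$ write $p=\sqrt{p_1^2+p_2^2+p_3^2}$. "Analytic" means real-analytic. For an $\mathbb{R}^3$-valued function $\vec p(s,t)$ consider $$\vec\omega=\vec p_t+\frac{p-\sin p}{p^3}\bigl(\vec p\,(\vec p\cdot\vec p_t)-p^2\,\vec p_t\bigr)-\frac{1-\cos p}{p^2}\,\vec p\times\vec p_t,\tag{1}$$ $$\vec\kappa=\vec p_s+\frac{p-\sin p}{p^3}\bigl(\vec p\,(\vec p\cdot\vec p_s)-p^2\,\vec p_s\bigr)-\frac{1-\cos p}{p^2}\,\vec p\times\vec p_s,\tag{2}$$ where the quotients $(p-\sin p)/p^3$ and $(1-\cos p)/p^2$ take their limit values $1/6$ and $1/2$ at $p=0$. Then (1), (2) with an arbitrary analytic $\vec p$ form the general analytic solution of $$\vec\kappa_t=\vec\omega_s-\vec\omega\times\vec\kappa.\tag{3}$$ That is, for every point $(s_0,t_0)\in\mathbb{R}^2$: (a) if $\vec p$ is analytic at $(s_0,t_0)$, then $\vec\omega$ and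 $\vec\kappa$ defined by (1) and (2) are analytic at $(s_0,t_0)$ and satisfy (3) in a neighbourhood of $(s_0,t_0)$; (b) conversely, if $\vec\omega$ and $\vec\kappa$ are $\mathbb{R}^3$-valued functions, analytic at $(s_0,t_0)$, that satisfy (3) in a neighbourhood of $(s_0,t_0)$, then for every $\vec p_0\in\mathbb{R}^3$ with $(\cos p_0-1)/p_0^2\neq 0$, where $p_0$ is the Euclidean length of $\vec p_0$ (the quotient being $-1/2$ at $p_0=0$), there is a function $\vec p(s,t)$, analytic at $(s_0,t_0)$, with $\vec p(s_0,t_0)=\vec p_0$, such that (1) and (2) hold in a neighbourhood of $(s_0,t_0)$. -/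

import Mathlib

open Filter Topology

namespace Cosserat

/-- Real three-component vectors. -/
abbrev Vec3 : Type := Fin 3 → ℝ

/-- Cross product of vectors. -/
def cross (a b : Vec3) : Vec3 := crossProduct a b

/-- The Euclidean length `p = √(p₁² + p₂² + p₃²)` of a vector. -/
noncomputable def len (p : Vec3) : ℝ := Real.sqrt (p 0 ^ 2 + p 1 ^ 2 + p 2 ^ 2)

/-- Partial derivative in `s` at `x = (s, t)` (used for differentiable functions). -/
noncomputable def partialS (f : ℝ × ℝ → Vec3) (x : ℝ × ℝ) : Vec3 := fderiv ℝ f x (1, 0)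

/-- Partial derivative in `t` at `x = (s, t)` (used for differentiable functions). -/
noncomputable def partialT (f : ℝ × ℝ → Vec3) (x : ℝ × ℝ) : Vec3 := fderiv ℝ f x (0, 1)

/-- `(r - sin r) / r³`, extended by its limit `1/6` at `r = 0`. -/
noncomputable def sinCoeff (r : ℝ) : ℝ := if r = 0 then 1 / 6 else (r - Real.sin r) / r ^ 3

/-- `(1 - cos r) / r²`, extended by its limit `1/2` at `r = 0`. -/
noncomputable def cosCoeff (r : ℝ) : ℝ := if r = 0 then 1 / 2 else (1 - Real.cos r) / r ^ 2

/-- `q + (p - sin p)/p³ (p (p ⬝ q) - p² q) - (1 - cos p)/p² (p × q)`. -/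
noncomputable def rodrigues (p q : Vec3) : Vec3 :=
  q + sinCoeff (len p) • ((p ⬝ᵥ q) • p - (len p) ^ 2 • q) - cosCoeff (len p) • cross p q

/-- The twist vector function `ω` built from `p`. -/
noncomputable def omegaOf (p : ℝ × ℝ → Vec3) (x : ℝ × ℝ) : Vec3 := rodrigues (p x) (partialT p x)

/-- The Darboux vector function `κ` built from `p`. -/
noncomputable def kappaOf (p : ℝ × ℝ → Vec3) (x : ℝ × ℝ) : Vec3 := rodrigues (p x) (partialS p x)

/-- The equation `κ_t = ω_s - ω × κ` at the point `x`. -/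
def FirstKinematicEq (ω κ : ℝ × ℝ → Vec3) (x : ℝ × ℝ) : Prop :=
  partialT κ x = partialS ω x - cross (ω x) (κ x)

end Cosserat

/-! Identify ℝ³ with the imaginary quaternions and put E = exp(p/2), which is `rotor p`. The
Rodrigues-type expression in (1) and (2) is the left-trivialized differential of this exponential
(`fderiv_rotor`), so (1) and (2) together say E⁻¹ dE = ½(κ ds + ω dt), and (3) is the Maurer–Cartan
(flatness) equation of the form on the right. Part (a) is then the symmetry of the second derivative
of E. For (b), the flat analytic form is integrated to Y with dY = Y·A and Y(x₀) = `rotor p₀`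
(`AnalyticAt.exists_flat_section`), and p is twice the imaginary part of a local logarithm of Y. The
logarithm exists because the differential of exp is injective exactly where `rodrigues_injective`
needs it: `cosCoeff (len p₀) ≠ 0`. Working in all of ℍ rather than on the unit sphere keeps the
inverse function theorem in a vector space. Integration is radial. Along rays dY = Y·A becomes a
Volterra equation in C([0,1], M), solved analytically in the parameter by inverting an operator
close to 1; flatness then yields a linear ODE forcing the non-radial defect to vanish. -/

/-! ### Analytic families of continuous paths. -/

section PathSpace

open unitInterval

variable {V M : Type*} [NormedAddCommGroup V] [NormedSpace ℝ V]

/-- The primitive `r ↦ ∫₀ʳ g` as a bounded operator on continuous paths. -/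
noncomputable def pathPrimitive (M : Type*) [NormedAddCommGroup M] [NormedSpace ℝ M]
    [CompleteSpace M] : C(I, M) →L[ℝ] C(I, M) :=
  LinearMap.mkContinuous
    { toFun := fun g =>
        ⟨fun r => ∫ s in (0 : ℝ)..r, Set.IccExtend zero_le_one g s, by
          have h := intervalIntegral.continuous_primitive
            (fun a b => (g.continuous.Icc_extend' (h := zero_le_one)).intervalIntegrable
              (μ := MeasureTheory.volume) a b) 0
          exact h.comp continuous_subtype_val⟩
      map_add' := fun g h => by
        ext r
        simp only [ContinuousMap.coe_mk, ContinuousMap.add_apply]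
        rw [← intervalIntegral.integral_add
          ((g.continuous.Icc_extend' (h := zero_le_one)).intervalIntegrable _ _)
          ((h.continuous.Icc_extend' (h := zero_le_one)).intervalIntegrable _ _)]
        rfl
      map_smul' := fun c g => by
        ext r
        simp only [ContinuousMap.coe_mk, ContinuousMap.smul_apply, RingHom.id_apply]
        rw [← intervalIntegral.integral_smul]
        rfl }
    1 (fun g => by
      rw [one_mul, ContinuousMap.norm_le _ (norm_nonneg g)]
      intro r
      have h := intervalIntegral.norm_integral_le_of_norm_le_const (a := (0 : ℝ)) (b := r)
        (f := Set.IccExtend zero_le_one g) (C := ‖g‖) (fun x _ => g.norm_coe_le_norm _)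
      refine h.trans ?_
      have h1 : |(r : ℝ) - 0| ≤ 1 := by
        rw [sub_zero, abs_of_nonneg r.2.1]; exact r.2.2
      exact mul_le_of_le_one_right (norm_nonneg g) h1)

theorem pathPrimitive_apply [NormedAddCommGroup M] [NormedSpace ℝ M] [CompleteSpace M]
    (g : C(I, M)) (r : I) :
    pathPrimitive M g r = ∫ s in (0 : ℝ)..r, Set.IccExtend zero_le_one g s := rfl

/-- The path `r ↦ r ^ k • m`. -/
noncomputable def monomialPath (M : Type*) [NormedAddCommGroup M] [NormedSpace ℝ M] (k : ℕ) :
    M →L[ℝ] C(I, M) :=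
  LinearMap.mkContinuous
    { toFun := fun m =>
        ⟨fun r => (r : ℝ) ^ k • m, (continuous_subtype_val.pow k).smul continuous_const⟩
      map_add' := fun a b => by ext r; simp
      map_smul' := fun c a => by ext r; exact smul_comm _ _ _ }
    1 (fun m => by
      rw [one_mul, ContinuousMap.norm_le _ (norm_nonneg m)]
      intro r
      simp only [LinearMap.coe_mk, AddHom.coe_mk, ContinuousMap.coe_mk, norm_smul, norm_pow]
      have : ‖(r : ℝ)‖ ≤ 1 := by rw [Real.norm_of_nonneg r.2.1]; exact r.2.2
      exact mul_le_of_le_one_left (norm_nonneg m) (pow_le_one₀ (norm_nonneg _) this))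

theorem norm_monomialPath_le [NormedAddCommGroup M] [NormedSpace ℝ M] (k : ℕ) :
    ‖monomialPath M k‖ ≤ 1 :=
  LinearMap.mkContinuous_norm_le _ zero_le_one _

/-- The radial quotients `r ↦ f (r x) / r` of an analytic function vanishing at the origin
form an analytic family of continuous paths. -/
theorem AnalyticAt.exists_radial_quotient [NormedAddCommGroup M] [NormedSpace ℝ M]
    [CompleteSpace M] {f : V → M} (hf : AnalyticAt ℝ f 0) (h0 : f 0 = 0) :
    ∃ P : V → C(I, M), AnalyticAt ℝ P 0 ∧ P 0 = 0 ∧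
      ∀ᶠ x in 𝓝 (0 : V), ∀ r : I, (r : ℝ) • P x r = f ((r : ℝ) • x) := by
  obtain ⟨p, ρ, hp⟩ := hf
  -- Dividing the degree-n term at r x by r leaves r^(n-1) times the term at x. Truncated
  -- subtraction at n = 0 is harmless, since the constant term is zero.
  let q : FormalMultilinearSeries ℝ V C(I, M) := fun n =>
    (monomialPath M (n - 1)).compContinuousMultilinearMap (p n)
  have hq : p.radius ≤ q.radius := by
    refine FormalMultilinearSeries.radius_le_of_le fun n => ?_
    refine (ContinuousLinearMap.norm_compContinuousMultilinearMap_le _ _).trans ?_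
    exact mul_le_of_le_one_left (norm_nonneg _) (norm_monomialPath_le _)
  have hr : 0 < q.radius := (hp.r_pos.trans_le hp.r_le).trans_le hq
  have hqs := q.hasFPowerSeriesOnBall hr
  have hp0 : ∀ v : Fin 0 → V, p 0 v = 0 := fun v => by rw [hp.coeff_zero v, h0]
  refine ⟨q.sum, hqs.analyticAt, ?_, ?_⟩
  · rw [← hqs.coeff_zero (fun _ => 0)]
    change monomialPath M _ (p 0 _) = 0
    rw [hp0, map_zero]
  · filter_upwards [Metric.eball_mem_nhds (0 : V) hp.r_pos] with x hx r
    have hx' : x ∈ Metric.eball (0 : V) q.radius :=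
      Metric.eball_subset_eball (hp.r_le.trans hq) hx
    have hrx : (r : ℝ) • x ∈ Metric.eball (0 : V) ρ := by
      rw [Metric.mem_eball, edist_zero_right] at hx ⊢
      refine lt_of_le_of_lt ?_ hx
      rw [enorm_smul]
      refine mul_le_of_le_one_left zero_le ?_
      rw [Real.enorm_of_nonneg r.2.1]
      exact ENNReal.ofReal_le_one.2 r.2.2
    have h1 := hqs.hasSum hx'
    rw [zero_add] at h1
    have h2 := ((ContinuousMap.evalCLM ℝ r).hasSum h1).const_smul (r : ℝ)
    have h3 := hp.hasSum hrx
    rw [zero_add] at h3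
    refine h2.unique ?_
    convert! h3 using 1
    funext n
    change (r : ℝ) • ((r : ℝ) ^ (n - 1) • p n fun _ => x) = p n fun _ => (r : ℝ) • x
    rcases n with _ | n
    · rw [hp0, hp0, smul_zero, smul_zero]
    · rw [smul_smul, ← pow_succ', Nat.add_sub_cancel, ContinuousMultilinearMap.map_smul_univ]
      simp

end PathSpace

/-! ### The radial equation as a Volterra fixed-point problem. -/

section RadialODE

open unitInterval

variable {V M : Type*} [NormedAddCommGroup V] [NormedSpace ℝ V] [NormedRing M] [NormedAlgebra ℝ M]
  [CompleteSpace M]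

/-- The Volterra operator `y ↦ (r ↦ ∫₀ʳ y b)` is bilinear in `b` and `y`. -/
theorem isBoundedBilinearMap_volterra (M : Type*) [NormedRing M] [NormedAlgebra ℝ M]
    [CompleteSpace M] :
    IsBoundedBilinearMap ℝ (fun q : C(I, M) × C(I, M) => pathPrimitive M (q.2 * q.1)) where
  add_left := fun a b y => by rw [mul_add, map_add]
  smul_left := fun k a y => by rw [mul_smul_comm, map_smul]
  add_right := fun a y z => by rw [add_mul, map_add]
  smul_right := fun k a y => by rw [smul_mul_assoc, map_smul]
  bound := by
    refine ⟨‖pathPrimitive M‖ + 1, by positivity, fun a y => ?_⟩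
    refine ((pathPrimitive M).le_opNorm _).trans ?_
    rw [mul_assoc, mul_comm ‖a‖]
    exact mul_le_mul (by linarith) (norm_mul_le _ _) (norm_nonneg _) (by positivity)

/-- Neumann series: the fixed point of `z ↦ c + W (P x) z` depends analytically on `x` near a zero
of `P`. -/
theorem IsBoundedBilinearMap.exists_analytic_fixedPoint {B : Type*} [NormedAddCommGroup B]
    [NormedSpace ℝ B] [CompleteSpace B] {W : B × B → B} (hW : IsBoundedBilinearMap ℝ W) {P : V → B}
    {x₀ : V} (hPa : AnalyticAt ℝ P x₀) (hP0 : P x₀ = 0) (c : B) :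
    ∃ y : V → B, AnalyticAt ℝ y x₀ ∧ y x₀ = c ∧
      ∀ᶠ x in 𝓝 x₀, ∀ z, z = c + W (P x, z) ↔ y x = z := by
  let w := hW.toContinuousLinearMap
  let R : V → B →L[ℝ] B := fun x => 1 - w (P x)
  have hRa : AnalyticAt ℝ R x₀ := analyticAt_const.sub ((w.analyticAt _).comp hPa)
  have hR0 : R x₀ = 1 := by simp [R, hP0]
  have hya : AnalyticAt ℝ (fun x => Ring.inverse (R x)) x₀ := by
    have h2 : AnalyticAt ℝ Ring.inverse (R x₀) := by
      rw [hR0]; exact analyticAt_inverse (1 : (B →L[ℝ] B)ˣ)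
    exact h2.comp hRa
  refine ⟨fun x => Ring.inverse (R x) c,
    ((ContinuousLinearMap.apply ℝ B c).analyticAt _).comp hya, by simp [hR0], ?_⟩
  have hunit : ∀ᶠ x in 𝓝 x₀, IsUnit (R x) := by
    refine hRa.continuousAt.eventually (p := fun T => IsUnit T) ?_
    rw [hR0]; exact Units.isOpen.mem_nhds isUnit_one
  filter_upwards [hunit] with x hx z
  have hRz : z = c + W (P x, z) ↔ R x z = c := by
    change _ ↔ z - W (P x, z) = c
    rw [sub_eq_iff_eq_add]
  rw [hRz]
  constructor
  · intro h
    rw [← h]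
    change (Ring.inverse (R x) * R x) z = z
    rw [Ring.inverse_mul_cancel _ hx]; rfl
  · rintro rfl
    change (R x * Ring.inverse (R x)) c = c
    rw [Ring.mul_inverse_cancel _ hx]; rfl

/-- The singular initial value problem `DY(x) x = Y(x) f(x)`, `Y(0) = y₀`, has an analytic
solution near the origin if `f` is analytic and `f 0 = 0`. -/
theorem AnalyticAt.exists_radial_solution {f : V → M} (hf : AnalyticAt ℝ f 0) (h0 : f 0 = 0)
    (y₀ : M) :
    ∃ Y : V → M, AnalyticAt ℝ Y 0 ∧ Y 0 = y₀ ∧ ∀ᶠ x in 𝓝 (0 : V), fderiv ℝ Y x x = Y x * f x := by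
  obtain ⟨P, hPa, hP0, hPf⟩ := hf.exists_radial_quotient h0
  -- On the ray through x the equation reads d/dr Y(r x) = Y(r x) P(x)(r), with f(r x)/r = P(x)(r).
  -- Both halves of the equivalence `hfix` matter: existence gives the path, uniqueness its
  -- compatibility with scaling.
  obtain ⟨y, hya, hy0, hfix⟩ := (isBoundedBilinearMap_volterra M).exists_analytic_fixedPoint hPa hP0
    (ContinuousMap.const I y₀)
  let Y : V → M := fun x => y x 1
  have heva : AnalyticAt ℝ (fun g : C(I, M) => g 1) (y 0) :=
    (ContinuousMap.evalCLM ℝ (1 : I) : C(I, M) →L[ℝ] M).analyticAt (y 0)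
  have hYa : AnalyticAt ℝ Y 0 := heva.comp hya
  refine ⟨Y, hYa, ?_, ?_⟩
  · simp [Y, hy0]
  obtain ⟨ε, hε, H⟩ := Metric.eventually_nhds_iff_ball.1
    ((hPf.and hfix).and hYa.eventually_analyticAt)
  filter_upwards [Metric.ball_mem_nhds (0 : V) hε] with x hx
  -- the integral equation
  have hvol : ∀ r : I, y x r = y₀ +
      ∫ s in (0 : ℝ)..r, Set.IccExtend zero_le_one (y x * P x : C(I, M)) s := by
    intro r
    have h2 := ((H x hx).1.2 (y x)).2 rfl
    have h3 := DFunLike.congr_fun h2 r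
    rwa [ContinuousMap.add_apply, pathPrimitive_apply] at h3
  -- invariance under scaling
  have hscale : ∀ ρ : I, Y ((ρ : ℝ) • x) = y x ρ := by
    intro ρ
    have hρx : (ρ : ℝ) • x ∈ Metric.ball (0 : V) ε := by
      rw [mem_ball_zero_iff] at hx ⊢
      refine lt_of_le_of_lt ?_ hx
      rw [norm_smul, Real.norm_of_nonneg ρ.2.1]
      exact mul_le_of_le_one_left (norm_nonneg _) ρ.2.2
    -- The path of x reparametrized by ρ solves the fixed-point equation at ρ x, hence is the path
    -- of ρ x.
    let z : C(I, M) := ⟨fun r => y x (ρ * r), by fun_prop⟩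
    have hz' : y ((ρ : ℝ) • x) = z := by
      refine ((H _ hρx).1.2 z).1 ?_
      ext r
      have h1 : pathPrimitive M (z * P ((ρ : ℝ) • x)) r =
          ∫ s in (0 : ℝ)..(ρ * r : I), Set.IccExtend zero_le_one (y x * P x : C(I, M)) s := by
        have h2 : ((ρ * r : I) : ℝ) = ρ * r := rfl
        rw [pathPrimitive_apply, h2]
        have h3 := intervalIntegral.smul_integral_comp_mul_left (a := (0 : ℝ)) (b := r)
          (Set.IccExtend zero_le_one (y x * P x : C(I, M))) (ρ : ℝ)
        rw [mul_zero] at h3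
        rw [← h3, ← intervalIntegral.integral_smul]
        -- The integrands are compared on an interval open at 0, because P(ρ x)(s) = ρ P(x)(ρ s) is
        -- obtained by cancelling a factor s.
        refine intervalIntegral.integral_congr_ae (Eventually.of_forall fun s hs => ?_)
        rw [Set.uIoc_of_le r.2.1] at hs
        have hs1 : s ∈ I := ⟨hs.1.le, hs.2.trans r.2.2⟩
        have hs2 : (ρ : ℝ) * s ∈ I := unitInterval.mul_mem ρ.2 hs1
        rw [Set.IccExtend_of_mem _ _ hs1, Set.IccExtend_of_mem _ _ hs2]
        have h4 : P ((ρ : ℝ) • x) ⟨s, hs1⟩ = (ρ : ℝ) • P x ⟨ρ * s, hs2⟩ := by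
          have h5 := (H _ hρx).1.1 ⟨s, hs1⟩
          have h6 := (H _ hx).1.1 ⟨ρ * s, hs2⟩
          have h7 : s ≠ 0 := hs.1.ne'
          have h8 : s • P ((ρ : ℝ) • x) ⟨s, hs1⟩ = s • (ρ : ℝ) • P x ⟨ρ * s, hs2⟩ := by
            rw [smul_smul, mul_comm s]
            refine h5.trans (Eq.trans ?_ h6.symm)
            rw [smul_smul, mul_comm]
          exact smul_right_injective _ h7 h8
        change y x (ρ * ⟨s, hs1⟩) * P ((ρ : ℝ) • x) ⟨s, hs1⟩ =
          (ρ : ℝ) • (y x ⟨ρ * s, hs2⟩ * P x ⟨ρ * s, hs2⟩)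
        rw [h4, mul_smul_comm]
        rfl
      rw [ContinuousMap.add_apply, h1]
      exact hvol (ρ * r)
    change y ((ρ : ℝ) • x) 1 = _
    rw [hz']
    change y x (ρ * 1) = y x ρ
    rw [mul_one]
  -- compare the two one-sided derivatives at `r = 1`
  have hcont : Continuous (Set.IccExtend zero_le_one (y x * P x : C(I, M))) :=
    (ContinuousMap.continuous _).Icc_extend'
  have hd1 : HasDerivAt
      (fun r : ℝ => y₀ + ∫ s in (0 : ℝ)..r, Set.IccExtend zero_le_one (y x * P x : C(I, M)) s)
      (Set.IccExtend zero_le_one (y x * P x : C(I, M)) 1) 1 :=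
    (intervalIntegral.integral_hasDerivAt_right (hcont.intervalIntegrable _ _)
      (hcont.stronglyMeasurableAtFilter _ _) hcont.continuousAt).const_add y₀
  have hd2 : HasDerivAt (fun r : ℝ => Y (r • x)) (fderiv ℝ Y x x) 1 := by
    have h1 : HasDerivAt (fun r : ℝ => r • x) x 1 := by
      simpa using (hasDerivAt_id (1 : ℝ)).smul_const x
    have h2 : HasFDerivAt Y (fderiv ℝ Y x) ((1 : ℝ) • x) := by
      rw [one_smul]; exact (H x hx).2.differentiableAt.hasFDerivAt
    exact h2.comp_hasDerivAt (1 : ℝ) h1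
  have heq : ∀ r ∈ I, Y (r • x) =
      y₀ + ∫ s in (0 : ℝ)..r, Set.IccExtend zero_le_one (y x * P x : C(I, M)) s := by
    intro r hr
    rw [← hvol ⟨r, hr⟩]
    exact hscale ⟨r, hr⟩
  have h1I : (1 : ℝ) ∈ I := ⟨zero_le_one, le_rfl⟩
  have hd3 := (hd1.hasDerivWithinAt (s := I)).congr heq (heq 1 h1I)
  rw [(uniqueDiffOn_Icc zero_lt_one 1 h1I).eq_deriv _ hd2.hasDerivWithinAt hd3,
    Set.IccExtend_of_mem _ _ h1I]
  have hf1 := (H x hx).1.1 1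
  simp only [Set.Icc.coe_one, one_smul] at hf1
  rw [← hf1]
  rfl

end RadialODE

/-! ### From radial solutions to flat sections. -/

section FlatSection

variable {V M : Type*} [NormedAddCommGroup V] [NormedSpace ℝ V] [NormedRing M] [NormedAlgebra ℝ M]
  [CompleteSpace M]

/-- A solution of the radial equation `DY(x) x = Y(x) A(x) x` of a flat connection form `A` solves
the full equation `DY(x) w = Y(x) A(x) w`. -/
theorem fderiv_eq_mul_of_radial_of_flat {A : V → V →L[ℝ] M} (hA : AnalyticAt ℝ A 0)
    (hflat : ∀ᶠ x in 𝓝 (0 : V), ∀ v w,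
      fderiv ℝ A x w v - fderiv ℝ A x v w = A x v * A x w - A x w * A x v)
    {Y : V → M} (hY : AnalyticAt ℝ Y 0)
    (hrad : ∀ᶠ x in 𝓝 (0 : V), fderiv ℝ Y x x = Y x * A x x) :
    ∀ᶠ x in 𝓝 (0 : V), ∀ w, fderiv ℝ Y x w = Y x * A x w := by
  have hbd : ∀ᶠ x in 𝓝 (0 : V), ‖A x‖ < ‖A 0‖ + 1 :=
    hA.continuousAt.norm.eventually (gt_mem_nhds (lt_add_one _))
  obtain ⟨ε, hε, H⟩ := Metric.eventually_nhds_iff_ball.1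
    (((hA.eventually_analyticAt.and hY.eventually_analyticAt).and (hflat.and hrad)).and hbd)
  filter_upwards [Metric.ball_mem_nhds (0 : V) hε] with v hv w
  have hmem : ∀ r ∈ Set.Icc (0 : ℝ) 1, r • v ∈ Metric.ball (0 : V) ε := by
    intro r hr
    rw [mem_ball_zero_iff] at hv ⊢
    refine lt_of_le_of_lt ?_ hv
    rw [norm_smul, Real.norm_of_nonneg hr.1]
    exact mul_le_of_le_one_left (norm_nonneg _) hr.2
  have hDA : ∀ y ∈ Metric.ball (0 : V) ε, HasFDerivAt A (fderiv ℝ A y) y := fun y hy =>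
    (H y hy).1.1.1.differentiableAt.hasFDerivAt
  have hDY : ∀ y ∈ Metric.ball (0 : V) ε, HasFDerivAt Y (fderiv ℝ Y y) y := fun y hy =>
    (H y hy).1.1.2.differentiableAt.hasFDerivAt
  have hDDY : ∀ y ∈ Metric.ball (0 : V) ε,
      HasFDerivAt (fderiv ℝ Y) (fderiv ℝ (fderiv ℝ Y) y) y := fun y hy =>
    (H y hy).1.1.2.fderiv.differentiableAt.hasFDerivAt
  -- the radial equation differentiated in the direction `w`
  have hradD : ∀ y ∈ Metric.ball (0 : V) ε, fderiv ℝ Y y w + fderiv ℝ (fderiv ℝ Y) y w y =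
      Y y * (A y w + fderiv ℝ A y w y) + fderiv ℝ Y y w * A y y := by
    intro y hy
    have h1 := (hDDY y hy).clm_apply (hasFDerivAt_id y)
    have h2 := (hDY y hy).mul' ((hDA y hy).clm_apply (hasFDerivAt_id y))
    have h3 : (fun x => fderiv ℝ Y x (id x)) =ᶠ[𝓝 y] fun x => Y x * A x (id x) := by
      filter_upwards [Metric.isOpen_ball.mem_nhds hy] with x hx
      exact (H x hx).1.2.2
    have h4 := DFunLike.congr_fun (h1.unique (h2.congr_of_eventuallyEq h3)) w
    simpa [mul_add] using h4
  -- The defect of the full equation along the ray, weighted by r so that its derivative absorbs the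
  -- undifferentiated term in `hradD`. Flatness, symmetry of the second derivative and the radial
  -- equation give z' = z·A(r v)v.
  let z : ℝ → M := fun r => r • (fderiv ℝ Y (r • v) w - Y (r • v) * A (r • v) w)
  have hz : ∀ r ∈ Set.Icc (0 : ℝ) 1, HasDerivAt z (z r * A (r • v) v) r := by
    intro r hr
    have hy := hmem r hr
    have hpath : HasDerivAt (fun r : ℝ => r • v) v r := by
      simpa using (hasDerivAt_id r).smul_const v
    have hAr : HasDerivAt (fun r : ℝ => A (r • v)) (fderiv ℝ A (r • v) v) r :=
      (hDA _ hy).comp_hasDerivAt r hpath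
    have hDr : HasDerivAt (fun r : ℝ => fderiv ℝ Y (r • v))
        (fderiv ℝ (fderiv ℝ Y) (r • v) v) r := (hDDY _ hy).comp_hasDerivAt r hpath
    have h1 : HasDerivAt (fun r : ℝ => fderiv ℝ Y (r • v) w)
        (fderiv ℝ (fderiv ℝ Y) (r • v) v w) r := by
      simpa using hDr.clm_apply (hasDerivAt_const r w)
    have h2 : HasDerivAt (fun r : ℝ => A (r • v) w) (fderiv ℝ A (r • v) v w) r := by
      simpa using hAr.clm_apply (hasDerivAt_const r w)
    have h3 : HasDerivAt (fun r : ℝ => Y (r • v)) (fderiv ℝ Y (r • v) v) r :=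
      (hDY _ hy).comp_hasDerivAt r hpath
    have h4 : HasDerivAt z (r • (fderiv ℝ (fderiv ℝ Y) (r • v) v w -
        (fderiv ℝ Y (r • v) v * A (r • v) w + Y (r • v) * fderiv ℝ A (r • v) v w)) +
        (1 : ℝ) • (fderiv ℝ Y (r • v) w - Y (r • v) * A (r • v) w)) r :=
      (hasDerivAt_id r).smul (h1.sub (h3.mul h2))
    refine h4.congr_deriv ?_
    have hR := hradD _ hy
    have hr0 := (H _ hy).1.2.2
    have hF := congrArg (fun m => Y (r • v) * m) ((H _ hy).1.2.1 v w)
    have hS : fderiv ℝ (fderiv ℝ Y) (r • v) w v = fderiv ℝ (fderiv ℝ Y) (r • v) v w := by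
      have : ContDiffAt ℝ (minSmoothness ℝ 2) Y (r • v) :=
        (H _ hy).1.1.2.contDiffAt
      exact (this.isSymmSndFDerivAt le_rfl).eq w v
    simp only [map_smul, mul_sub, mul_add, mul_smul_comm, sub_mul,
      smul_mul_assoc, one_smul, z] at hR hr0 hF ⊢
    rw [hS] at hR
    have hr1 := congrArg (fun m => m * A (r • v) w) hr0
    simp only [smul_mul_assoc, mul_assoc] at hR hr1 hF ⊢
    linear_combination (norm := module) hR + r • hF - hr1
  have hz0 : z 1 = 0 := by
    -- Grönwall: z(0) = 0, and `A` is bounded by ‖A 0‖ + 1 on the ball.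
    refine eq_zero_of_abs_deriv_le_mul_abs_self_of_eq_zero_right (a := 0) (b := 1)
      (K := (‖A 0‖ + 1) * ‖v‖) (fun r hr => (hz r hr).continuousAt.continuousWithinAt)
      (fun r hr => (hz r (Set.Ico_subset_Icc_self hr)).hasDerivWithinAt) (by simp [z])
      (fun r hr => ?_) 1 ⟨zero_le_one, le_rfl⟩
    rw [mul_comm _ ‖z r‖]
    refine (norm_mul_le _ _).trans (mul_le_mul_of_nonneg_left ?_ (norm_nonneg _))
    refine ((A (r • v)).le_opNorm v).trans (mul_le_mul_of_nonneg_right ?_ (norm_nonneg _))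
    exact (H _ (hmem r (Set.Ico_subset_Icc_self hr))).2.le
  simpa [z, sub_eq_zero] using hz0

/-- Analytic integrability of flat connections: if the connection form `A` is analytic and flat
near `x₀`, the equation `DY(x) w = Y(x) A(x) w`, `Y(x₀) = y₀`, has an analytic solution near
`x₀`. -/
theorem AnalyticAt.exists_flat_section {x₀ : V} {A : V → V →L[ℝ] M} (hA : AnalyticAt ℝ A x₀)
    (hflat : ∀ᶠ x in 𝓝 x₀, ∀ v w,
      fderiv ℝ A x w v - fderiv ℝ A x v w = A x v * A x w - A x w * A x v) (y₀ : M) :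
    ∃ Y : V → M, AnalyticAt ℝ Y x₀ ∧ Y x₀ = y₀ ∧
      ∀ᶠ x in 𝓝 x₀, ∀ w, fderiv ℝ Y x w = Y x * A x w := by
  let B : V → V →L[ℝ] M := fun x => A (x + x₀)
  have htr : Tendsto (fun x : V => x + x₀) (𝓝 0) (𝓝 x₀) := by
    have : Continuous fun x : V => x + x₀ := by fun_prop
    simpa using this.tendsto 0
  have htr' : Tendsto (fun x : V => x - x₀) (𝓝 x₀) (𝓝 0) := by
    have : Continuous fun x : V => x - x₀ := by fun_prop
    simpa using this.tendsto x₀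
  have hB : AnalyticAt ℝ B 0 := by
    refine AnalyticAt.fun_comp (g := A) (f := fun x => x + x₀) ?_ (analyticAt_id.add analyticAt_const)
    simpa using hA
  have hBflat : ∀ᶠ x in 𝓝 (0 : V), ∀ v w,
      fderiv ℝ B x w v - fderiv ℝ B x v w = B x v * B x w - B x w * B x v := by
    filter_upwards [htr.eventually hflat] with x hx v w
    have : fderiv ℝ B x = fderiv ℝ A (x + x₀) := fderiv_comp_add_right x₀
    rw [this]
    exact hx v w
  have hBx : AnalyticAt ℝ (fun x => B x x) 0 := by
    have h := (ContinuousLinearMap.id ℝ (V →L[ℝ] M)).analyticAt_bilinear (B 0, (0 : V))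
    exact h.comp₂ hB analyticAt_id
  obtain ⟨Y, hY, hY0, hrad⟩ := hBx.exists_radial_solution (by simp) y₀
  have hsol := fderiv_eq_mul_of_radial_of_flat hB hBflat hY hrad
  refine ⟨fun x => Y (x - x₀), ?_, by simpa using hY0, ?_⟩
  · refine AnalyticAt.fun_comp (g := Y) (f := fun x => x - x₀) ?_ (analyticAt_id.sub analyticAt_const)
    simpa using hY
  · filter_upwards [htr'.eventually hsol] with x hx w
    have h1 : fderiv ℝ (fun x => Y (x - x₀)) x = fderiv ℝ Y (x - x₀) := by
      simpa only [sub_eq_add_neg] using fderiv_comp_add_right (-x₀)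
    rw [h1, hx w]
    simp [B]

end FlatSection

/-! ### Quaternions and the differential of the exponential map. -/

namespace Cosserat

open scoped Quaternion

/-- The purely imaginary quaternion of a vector. -/
noncomputable def pureQuat : Vec3 →L[ℝ] ℍ[ℝ] :=
  LinearMap.toContinuousLinearMap
    { toFun := fun p => ⟨0, p 0, p 1, p 2⟩
      map_add' := fun _ _ => QuaternionAlgebra.ext (add_zero 0).symm rfl rfl rfl
      map_smul' := fun c _ => QuaternionAlgebra.ext (mul_zero c).symm rfl rfl rfl }

/-- The imaginary part of a quaternion as a vector. -/
noncomputable def imVec : ℍ[ℝ] →L[ℝ] Vec3 :=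
  LinearMap.toContinuousLinearMap
    { toFun := fun X => ![X.imI, X.imJ, X.imK]
      map_add' := fun X Y => by simp
      map_smul' := fun c X => by simp }

/-- The real part of a quaternion. -/
noncomputable def rePart : ℍ[ℝ] →L[ℝ] ℝ :=
  LinearMap.toContinuousLinearMap
    { toFun := fun X => X.re
      map_add' := fun X Y => by simp
      map_smul' := fun c X => by simp }

@[simp] theorem pureQuat_re (p : Vec3) : (pureQuat p).re = 0 := rfl
@[simp] theorem pureQuat_imI (p : Vec3) : (pureQuat p).imI = p 0 := rfl
@[simp] theorem pureQuat_imJ (p : Vec3) : (pureQuat p).imJ = p 1 := rfl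
@[simp] theorem pureQuat_imK (p : Vec3) : (pureQuat p).imK = p 2 := rfl

theorem imVec_apply (X : ℍ[ℝ]) : imVec X = ![X.imI, X.imJ, X.imK] := rfl

@[simp] theorem rePart_apply (X : ℍ[ℝ]) : rePart X = X.re := rfl

@[simp] theorem imVec_pureQuat (p : Vec3) : imVec (pureQuat p) = p := by
  rw [imVec_apply]; ext i; fin_cases i <;> rfl

@[simp] theorem imVec_coe (r : ℝ) : imVec (r : ℍ[ℝ]) = 0 := by
  rw [imVec_apply]; ext i; fin_cases i <;> rfl

theorem pureQuat_imVec (X : ℍ[ℝ]) : pureQuat (imVec X) = X.im := by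
  ext <;> simp [imVec_apply]

/-- The factor 2 is what the half in `rotor` compensates, so that the cross product enters (3) with
coefficient 1. -/
theorem pureQuat_mul_sub_mul (a b : Vec3) :
    pureQuat a * pureQuat b - pureQuat b * pureQuat a = (2 : ℝ) • pureQuat (cross a b) := by
  ext <;> simp [cross, cross_apply] <;> ring

theorem len_sq (p : Vec3) : len p ^ 2 = p 0 ^ 2 + p 1 ^ 2 + p 2 ^ 2 :=
  Real.sq_sqrt (by positivity)

theorem len_eq_zero {p : Vec3} : len p = 0 ↔ p = 0 := by
  constructor
  · intro h
    have h1 := len_sq p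
    rw [h] at h1
    ext i
    have : p i ^ 2 = 0 := by
      fin_cases i <;> simp only [Fin.zero_eta, Fin.mk_one, Fin.reduceFinMk] <;>
        nlinarith [sq_nonneg (p 0), sq_nonneg (p 1), sq_nonneg (p 2)]
    exact pow_eq_zero_iff two_ne_zero |>.1 this
  · rintro rfl; simp [len]

/-- The unit quaternion with rotation vector `p`. -/
noncomputable def rotor (p : Vec3) : ℍ[ℝ] := NormedSpace.exp ((1 / 2 : ℝ) • pureQuat p)

theorem norm_pureQuat (p : Vec3) : ‖pureQuat p‖ = len p := by
  have h : ‖pureQuat p‖ * ‖pureQuat p‖ = len p * len p := by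
    rw [← Quaternion.normSq_eq_norm_mul_self, Quaternion.normSq_def', ← sq (len p), len_sq]
    simp
  exact (mul_self_inj (norm_nonneg _) (Real.sqrt_nonneg _)).1 h

theorem rotor_eq (p : Vec3) :
    rotor p = Real.cos (len p / 2) • (1 : ℍ[ℝ]) + (Real.sin (len p / 2) / len p) • pureQuat p := by
  have hn : ‖(1 / 2 : ℝ) • pureQuat p‖ = len p / 2 := by
    rw [norm_smul, norm_pureQuat]; norm_num; ring
  rw [rotor, Quaternion.exp_of_re_eq_zero _ (by simp), hn, smul_smul]
  congr 1
  · ext <;> simp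
  · congr 1
    by_cases h : len p = 0
    · simp [h]
    · field_simp

/-- The real part is central and splits off as a scalar; the 2 undoes the half in `rotor`. -/
theorem exp_eq_smul_rotor (X : ℍ[ℝ]) :
    NormedSpace.exp X = Real.exp X.re • rotor ((2 : ℝ) • imVec X) := by
  have h : (1 / 2 : ℝ) • pureQuat ((2 : ℝ) • imVec X) = X.im := by
    rw [map_smul, pureQuat_imVec, smul_smul]; norm_num
  rw [rotor, h, Quaternion.exp_of_re_eq_zero _ (Quaternion.re_im X), Quaternion.exp_eq X,
    Real.exp_eq_exp_ℝ]

theorem analyticAt_rotor (p : Vec3) : AnalyticAt ℝ rotor p :=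
  (NormedSpace.exp_analytic (𝕂 := ℝ) _).fun_comp
    (((1 / 2 : ℝ) • pureQuat : Vec3 →L[ℝ] ℍ[ℝ]).analyticAt p)

theorem exp_ne_zero (X : ℍ[ℝ]) : NormedSpace.exp X ≠ 0 := by
  rw [← norm_ne_zero_iff, Quaternion.norm_exp, ← Real.exp_eq_exp_ℝ, Real.norm_eq_abs, Real.abs_exp]
  exact (Real.exp_pos _).ne'

theorem rotor_ne_zero (p : Vec3) : rotor p ≠ 0 := exp_ne_zero _

theorem rotor_neg_mul_rotor (p : Vec3) : rotor (-p) * rotor p = 1 := by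
  let +nondep : NormedAlgebra ℚ ℍ[ℝ] := .restrictScalars ℚ ℝ ℍ[ℝ]
  rw [rotor, map_neg, smul_neg, NormedSpace.exp_neg]
  exact inv_mul_cancel₀ (rotor_ne_zero p)

theorem hasDerivAt_len {p : Vec3} (hp : len p ≠ 0) (q : Vec3) :
    HasDerivAt (fun τ : ℝ => len (p + τ • q)) ((p ⬝ᵥ q) / len p) 0 := by
  have hi : ∀ i, HasDerivAt (fun τ : ℝ => (p + τ • q) i) (q i) 0 := fun i => by
    simpa using ((hasDerivAt_id (0 : ℝ)).mul_const (q i)).const_add (p i)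
  have h0 : p + (0 : ℝ) • q = p := by simp
  have h : HasDerivAt (fun τ : ℝ => (p + τ • q) 0 ^ 2 + (p + τ • q) 1 ^ 2 + (p + τ • q) 2 ^ 2)
      (2 * p 0 * q 0 + 2 * p 1 * q 1 + 2 * p 2 * q 2) 0 := by
    have := (((hi 0).fun_pow 2).fun_add ((hi 1).fun_pow 2)).fun_add ((hi 2).fun_pow 2)
    rw [h0] at this
    simpa using this
  have h' := h.sqrt (by rw [h0, ← len_sq]; exact pow_ne_zero 2 hp)
  refine h'.congr_deriv ?_
  rw [h0]
  simp only [len, dotProduct, Fin.sum_univ_three]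
  have hs : Real.sqrt (p 0 ^ 2 + p 1 ^ 2 + p 2 ^ 2) ≠ 0 := hp
  field_simp

/-- Differential of the exponential map of the unit quaternions in left trivialization. -/
theorem fderiv_rotor (p q : Vec3) :
    fderiv ℝ rotor p q = rotor p * ((1 / 2 : ℝ) • pureQuat (rodrigues p q)) := by
  have hd : HasDerivAt (fun τ : ℝ => rotor (p + τ • q)) (fderiv ℝ rotor p q) 0 := by
    have h1 : HasDerivAt (fun τ : ℝ => p + τ • q) q 0 := by
      simpa using ((hasDerivAt_id (0 : ℝ)).smul_const q).const_add p
    have h2 : HasFDerivAt rotor (fderiv ℝ rotor p) (p + (0 : ℝ) • q) := by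
      simpa using (analyticAt_rotor p).differentiableAt.hasFDerivAt
    exact h2.comp_hasDerivAt (0 : ℝ) h1
  -- `len` is not differentiable at 0; there the curve is the one-parameter group generated by q/2.
  by_cases hp : len p = 0
  · obtain rfl := len_eq_zero.1 hp
    have h1 : HasDerivAt (fun τ : ℝ => rotor (0 + τ • q)) ((1 / 2 : ℝ) • pureQuat q) 0 := by
      have h := hasDerivAt_exp_smul_const (𝕂 := ℝ) ((1 / 2 : ℝ) • pureQuat q) (0 : ℝ)
      simp only [zero_smul, NormedSpace.exp_zero, one_mul] at h
      refine h.congr_of_eventuallyEq (Eventually.of_forall fun τ => ?_)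
      simp only [rotor, zero_add, map_smul]
      rw [smul_comm]
    rw [hd.unique h1]
    have h2 : rodrigues 0 q = q := by
      ext i; fin_cases i <;> simp [rodrigues, hp, cross]
    simp [h2, rotor]
  · have hl := hasDerivAt_len hp q
    have h0 : p + (0 : ℝ) • q = p := by simp
    have hc : HasDerivAt (fun τ : ℝ => Real.cos (len (p + τ • q) / 2))
        (-Real.sin (len p / 2) * ((p ⬝ᵥ q) / len p / 2)) 0 := by
      have := (hl.div_const 2).cos
      rwa [h0] at this
    have hs : HasDerivAt (fun τ : ℝ => Real.sin (len (p + τ • q) / 2) / len (p + τ • q))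
        ((Real.cos (len p / 2) * ((p ⬝ᵥ q) / len p / 2) * len p -
          Real.sin (len p / 2) * ((p ⬝ᵥ q) / len p)) / len p ^ 2) 0 := by
      have := (hl.div_const 2).sin.div hl (by rwa [h0])
      rwa [h0] at this
    have hq : HasDerivAt (fun τ : ℝ => pureQuat (p + τ • q)) (pureQuat q) 0 := by
      simp only [map_add, map_smul]
      simpa using ((hasDerivAt_id (0 : ℝ)).smul_const (pureQuat q)).const_add (pureQuat p)
    have h1 := (hc.smul_const (1 : ℍ[ℝ])).add (hs.smul hq)
    have h2 := hd.unique (h1.congr_of_eventuallyEq (Eventually.of_forall fun τ => rotor_eq _))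
    rw [h2, h0, rotor_eq]
    have ha : sinCoeff (len p) =
        (len p - 2 * Real.sin (len p / 2) * Real.cos (len p / 2)) / len p ^ 3 := by
      rw [sinCoeff, if_neg hp, ← Real.sin_two_mul, mul_div_cancel₀ _ two_ne_zero]
    have hb : cosCoeff (len p) = 2 * Real.sin (len p / 2) ^ 2 / len p ^ 2 := by
      have := Real.cos_two_mul (len p / 2)
      rw [mul_div_cancel₀ _ two_ne_zero, Real.cos_sq'] at this
      rw [cosCoeff, if_neg hp, this]
      ring
    have hL := len_sq p
    have hcs := Real.sin_sq_add_cos_sq (len p / 2)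
    simp only [rodrigues]
    set ℓ := len p
    set s := Real.sin (ℓ / 2)
    set c := Real.cos (ℓ / 2)
    set a := sinCoeff ℓ
    set b := cosCoeff ℓ
    -- Half-angle identities matching coefficients in the quaternion product: `e1` for (p·q) p, `e2`
    -- for q, `e3` for the vanishing of p × q.
    have e1 : c * a - s / ℓ * b = c / ℓ ^ 2 - 2 * s / ℓ ^ 3 := by
      rw [ha, hb]; field_simp; linear_combination (-2 * s) * hcs
    have e2 : c * (1 - a * ℓ ^ 2) + s / ℓ * b * ℓ ^ 2 = 2 * s / ℓ := by
      rw [ha, hb]; field_simp; linear_combination (2 * s) * hcs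
    have e3 : c * b = s / ℓ * (1 - a * ℓ ^ 2) := by
      rw [ha, hb]; field_simp; ring
    have e4 : (c * ((p ⬝ᵥ q) / ℓ / 2) * ℓ - s * ((p ⬝ᵥ q) / ℓ)) / ℓ ^ 2 =
        (p ⬝ᵥ q) / 2 * (c / ℓ ^ 2 - 2 * s / ℓ ^ 3) := by
      field_simp
    rw [e4, ← e1]
    have e5 : s * ((p ⬝ᵥ q) / ℓ / 2) = s / ℓ * ((p ⬝ᵥ q) / 2) := by ring
    have e6 : s / ℓ = (c * (1 - a * ℓ ^ 2) + s / ℓ * b * ℓ ^ 2) / 2 := by rw [e2]; ring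
    rw [neg_mul, e5]
    generalize s / ℓ = σ at e3 e6 ⊢
    clear_value ℓ s c a b
    clear hd h1 h2 hc hs hl e1 e2 e4 e5
    simp only [dotProduct, Fin.sum_univ_three]
    ext
    · simp [cross, cross_apply, Matrix.vecHead, Matrix.vecTail, -one_div]
      linear_combination (-σ / 2 * a * (p 0 * q 0 + p 1 * q 1 + p 2 * q 2)) * hL
    · simp [cross, cross_apply, Matrix.vecHead, Matrix.vecTail, -one_div]
      linear_combination q 0 * e6 + ((p 1 * q 2 - p 2 * q 1) / 2) * e3 +
        (σ * b * q 0 / 2) * hL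
    · simp [cross, cross_apply, Matrix.vecHead, Matrix.vecTail, -one_div]
      linear_combination q 1 * e6 + ((p 2 * q 0 - p 0 * q 2) / 2) * e3 +
        (σ * b * q 1 / 2) * hL
    · simp [cross, cross_apply, Matrix.vecHead, Matrix.vecTail, -one_div]
      linear_combination q 2 * e6 + ((p 0 * q 1 - p 1 * q 0) / 2) * e3 +
        (σ * b * q 2 / 2) * hL

/-- Left trivialized derivative of `rotor ∘ p`. -/
theorem fderiv_rotor_comp {E : Type*} [NormedAddCommGroup E] [NormedSpace ℝ E] {p : E → Vec3}
    {x : E} (hp : DifferentiableAt ℝ p x) (v : E) :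
    fderiv ℝ (fun y => rotor (p y)) x v =
      rotor (p x) * ((1 / 2 : ℝ) • pureQuat (rodrigues (p x) (fderiv ℝ p x v))) := by
  have h := (analyticAt_rotor (p x)).differentiableAt.hasFDerivAt.comp x hp.hasFDerivAt
  rw [← fderiv_rotor]
  exact DFunLike.congr_fun h.fderiv v

/-! ### Direct half: every analytic p gives a solution. -/

/-- The defining formula goes through `len`, which is not analytic at 0. Analyticity is read off
instead from 2 E⁻¹ dE with E = `rotor ∘ p`, where E⁻¹ = `rotor (-p)` is visibly analytic. -/
theorem analyticAt_rodrigues_fderiv {E : Type*} [NormedAddCommGroup E] [NormedSpace ℝ E]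
    {p : E → Vec3} {x : E} (hp : AnalyticAt ℝ p x) (v : E) :
    AnalyticAt ℝ (fun y => rodrigues (p y) (fderiv ℝ p y v)) x := by
  have h1 : AnalyticAt ℝ (fun y => rotor (-p y)) x :=
    (analyticAt_rotor _).fun_comp hp.neg
  have h2 : AnalyticAt ℝ (fun y => fderiv ℝ (fun y => rotor (p y)) y v) x :=
    ((ContinuousLinearMap.apply ℝ ℍ[ℝ] v).analyticAt _).fun_comp
      ((analyticAt_rotor _).fun_comp hp).fderiv
  have h3 : AnalyticAt ℝ (fun y => imVec ((2 : ℝ) •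
      (rotor (-p y) * fderiv ℝ (fun y => rotor (p y)) y v))) x :=
    (imVec.analyticAt _).fun_comp (analyticAt_const.fun_smul (h1.fun_mul h2))
  refine h3.congr ?_
  filter_upwards [hp.eventually_analyticAt] with y hy
  rw [fderiv_rotor_comp hy.differentiableAt, ← mul_assoc, rotor_neg_mul_rotor, one_mul, smul_smul]
  norm_num

/-- Compute both mixed second derivatives of E = `rotor ∘ p` from dE = E·A, equate them and cancel
E; the remaining commutator is the cross product. -/
theorem firstKinematicEq_of_analyticAt {p : ℝ × ℝ → Vec3} {x : ℝ × ℝ} (hp : AnalyticAt ℝ p x) :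
    FirstKinematicEq (omegaOf p) (kappaOf p) x := by
  let E : ℝ × ℝ → ℍ[ℝ] := fun y => rotor (p y)
  have hE : AnalyticAt ℝ E x := (analyticAt_rotor _).fun_comp hp
  have hE2 : HasFDerivAt (fderiv ℝ E) (fderiv ℝ (fderiv ℝ E) x) x :=
    hE.fderiv.differentiableAt.hasFDerivAt
  let W : ℝ × ℝ → ℝ × ℝ → Vec3 := fun v y => rodrigues (p y) (fderiv ℝ p y v)
  have hsnd : ∀ v w, fderiv ℝ (fderiv ℝ E) x w v =
      E x * ((1 / 2 : ℝ) • pureQuat (W w x)) * ((1 / 2 : ℝ) • pureQuat (W v x)) +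
        E x * ((1 / 2 : ℝ) • pureQuat (fderiv ℝ (W v) x w)) := by
    intro v w
    have hW : HasFDerivAt (W v) (fderiv ℝ (W v) x) x :=
      (analyticAt_rodrigues_fderiv hp v).differentiableAt.hasFDerivAt
    have h1 : HasFDerivAt (fun y => fderiv ℝ E y v) ((fderiv ℝ (fderiv ℝ E) x).flip v) x := by
      simpa using hE2.clm_apply (hasFDerivAt_const v x)
    have h2 := hE.differentiableAt.hasFDerivAt.mul'
      (((1 / 2 : ℝ) • pureQuat : Vec3 →L[ℝ] ℍ[ℝ]).hasFDerivAt.comp x hW)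
    have h3 : (fun y => fderiv ℝ E y v) =ᶠ[𝓝 x]
        (E * (((1 / 2 : ℝ) • pureQuat : Vec3 →L[ℝ] ℍ[ℝ]) ∘ W v)) := by
      filter_upwards [hp.eventually_analyticAt] with y hy
      exact fderiv_rotor_comp hy.differentiableAt v
    have h4 := DFunLike.congr_fun (h1.unique (h2.congr_of_eventuallyEq h3)) w
    have h5 : fderiv ℝ E x w = E x * ((1 / 2 : ℝ) • pureQuat (W w x)) :=
      fderiv_rotor_comp hp.differentiableAt w
    rw [← h5, add_comm]
    exact h4
  have hsymm : fderiv ℝ (fderiv ℝ E) x (0, 1) (1, 0) = fderiv ℝ (fderiv ℝ E) x (1, 0) (0, 1) := by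
    have : ContDiffAt ℝ (minSmoothness ℝ 2) E x := hE.contDiffAt
    exact (this.isSymmSndFDerivAt le_rfl).eq _ _
  rw [hsnd, hsnd, mul_assoc, mul_assoc, ← mul_add, ← mul_add] at hsymm
  have h := mul_left_cancel₀ (rotor_ne_zero (p x)) hsymm
  change fderiv ℝ (W (1, 0)) x (0, 1) =
    fderiv ℝ (W (0, 1)) x (1, 0) - cross (W (0, 1) x) (W (1, 0) x)
  have hc := pureQuat_mul_sub_mul (W (0, 1) x) (W (1, 0) x)
  simp only [smul_mul_smul_comm] at h
  have h6 : pureQuat (fderiv ℝ (W (1, 0)) x (0, 1)) =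
      pureQuat (fderiv ℝ (W (0, 1)) x (1, 0) - cross (W (0, 1) x) (W (1, 0) x)) := by
    rw [map_sub]
    linear_combination (norm := module) (2 : ℝ) • h - (1 / 2 : ℝ) • hc
  simpa using congrArg imVec h6

/-! ### Local inversion of the quaternion exponential. -/

/-- The differential of the quaternion exponential in left trivialization. -/
theorem fderiv_quaternion_exp (X u : ℍ[ℝ]) :
    fderiv ℝ NormedSpace.exp X u = NormedSpace.exp X * ((rePart u : ℍ[ℝ]) +
      (1 / 2 : ℝ) • pureQuat (rodrigues ((2 : ℝ) • imVec X) ((2 : ℝ) • imVec u))) := by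
  have h1 : HasFDerivAt (fun X : ℍ[ℝ] => Real.exp (rePart X)) (Real.exp (rePart X) • rePart) X :=
    rePart.hasFDerivAt.exp
  have h2 : DifferentiableAt ℝ (fun X : ℍ[ℝ] => ((2 : ℝ) • imVec) X) X :=
    ((2 : ℝ) • imVec).differentiableAt
  have h3 : DifferentiableAt ℝ (fun X : ℍ[ℝ] => rotor (((2 : ℝ) • imVec) X)) X :=
    (analyticAt_rotor _).differentiableAt.comp X h2
  have h4 := h1.fun_smul h3.hasFDerivAt
  have h5 : (NormedSpace.exp : ℍ[ℝ] → ℍ[ℝ]) =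
      fun X => Real.exp (rePart X) • rotor (((2 : ℝ) • imVec) X) := by
    funext X; exact exp_eq_smul_rotor X
  rw [h5, HasFDerivAt.fderiv h4]
  have h6 := fderiv_rotor_comp h2 u
  have h7 : fderiv ℝ (fun X : ℍ[ℝ] => ((2 : ℝ) • imVec) X) X u = (2 : ℝ) • imVec u := by
    rw [ContinuousLinearMap.fderiv]; rfl
  rw [h7] at h6
  simp only [add_apply, smul_apply, ContinuousLinearMap.smulRight_apply] at h6 ⊢
  rw [h6, mul_add, ← Quaternion.coe_commutes, Quaternion.coe_mul_eq_smul]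
  simp only [smul_mul_assoc, smul_smul, smul_eq_mul]
  rw [add_comm, mul_comm (rePart u)]

theorem rodrigues_injective {p q : Vec3} (hp : cosCoeff (len p) ≠ 0) (h : rodrigues p q = 0) :
    q = 0 := by
  have hL := len_sq p
  by_cases h0 : len p = 0
  · have := len_eq_zero.1 h0
    subst this
    have h2 : rodrigues 0 q = q := by
      ext i; fin_cases i <;> simp [rodrigues, h0, cross]
    rw [← h2, h]
  simp only [rodrigues] at h
  rw [hL] at h
  set a := sinCoeff (len p)
  set b := cosCoeff (len p)
  have c0 := congrFun h 0
  have c1 := congrFun h 1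
  have c2 := congrFun h 2
  simp [cross, cross_apply, dotProduct, Fin.sum_univ_three] at c0 c1 c2
  -- Pairing with p gives p·q = 0, pairing with p × q gives `b` |p × q|² = 0, and Lagrange's
  -- identity turns these into |p|²|q|² = 0.
  have hd : p 0 * q 0 + p 1 * q 1 + p 2 * q 2 = 0 := by
    linear_combination p 0 * c0 + p 1 * c1 + p 2 * c2
  have hx : (p 1 * q 2 - p 2 * q 1) ^ 2 + (p 2 * q 0 - p 0 * q 2) ^ 2 +
      (p 0 * q 1 - p 1 * q 0) ^ 2 = 0 := by
    refine (mul_eq_zero.1 ?_).resolve_left hp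
    linear_combination -(p 1 * q 2 - p 2 * q 1) * c0 - (p 2 * q 0 - p 0 * q 2) * c1 -
      (p 0 * q 1 - p 1 * q 0) * c2
  have hq : len p ^ 2 * (q 0 ^ 2 + q 1 ^ 2 + q 2 ^ 2) = 0 := by
    rw [hL]
    linear_combination hx + (p 0 * q 0 + p 1 * q 1 + p 2 * q 2) * hd
  rw [← len_sq q] at hq
  have := (mul_eq_zero.1 hq).resolve_left (pow_ne_zero 2 h0)
  exact len_eq_zero.1 (pow_eq_zero_iff two_ne_zero |>.1 this)

/-- The quaternion logarithm: near a point where its differential is injective, the quaternion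
exponential has an analytic right inverse. -/
theorem exists_analytic_log {p₀ : Vec3} (h₀ : cosCoeff (len p₀) ≠ 0) :
    ∃ g : ℍ[ℝ] → ℍ[ℝ], AnalyticAt ℝ g (rotor p₀) ∧ g (rotor p₀) = (1 / 2 : ℝ) • pureQuat p₀ ∧
      ∀ᶠ y in 𝓝 (rotor p₀), NormedSpace.exp (g y) = y := by
  let X₀ : ℍ[ℝ] := (1 / 2 : ℝ) • pureQuat p₀
  have hX₀ : (2 : ℝ) • imVec X₀ = p₀ := by simp [X₀]
  have ha : AnalyticAt ℝ (NormedSpace.exp : ℍ[ℝ] → ℍ[ℝ]) X₀ :=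
    NormedSpace.exp_analytic (𝕂 := ℝ) X₀
  have hinj : Function.Injective (fderiv ℝ (NormedSpace.exp : ℍ[ℝ] → ℍ[ℝ]) X₀).toLinearMap := by
    rw [← LinearMap.ker_eq_bot, LinearMap.ker_eq_bot']
    intro u hu
    have hu' : fderiv ℝ (NormedSpace.exp : ℍ[ℝ] → ℍ[ℝ]) X₀ u = 0 := hu
    rw [fderiv_quaternion_exp, hX₀] at hu'
    have h1 := (mul_eq_zero.1 hu').resolve_left (exp_ne_zero _)
    have h2 : u.re = 0 := by simpa using congrArg rePart h1
    have h3 : rodrigues p₀ ((2 : ℝ) • imVec u) = 0 := by simpa using congrArg imVec h1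
    have h4 : imVec u = 0 := by simpa using rodrigues_injective h₀ h3
    rw [← Quaternion.re_add_im u, h2, ← pureQuat_imVec, h4]
    simp
  let e : ℍ[ℝ] ≃L[ℝ] ℍ[ℝ] := (LinearEquiv.ofInjectiveEndo _ hinj).toContinuousLinearEquiv
  have he : fderiv ℝ (NormedSpace.exp : ℍ[ℝ] → ℍ[ℝ]) X₀ = e := by
    ext1 u; rfl
  have hs : HasStrictFDerivAt (NormedSpace.exp : ℍ[ℝ] → ℍ[ℝ]) (e : ℍ[ℝ] →L[ℝ] ℍ[ℝ]) X₀ := by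
    rw [← he]; exact ha.hasStrictFDerivAt
  refine ⟨hs.localInverse _ _ _, ?_, hs.localInverse_apply_image, hs.eventually_right_inverse⟩
  exact (hs.toOpenPartialHomeomorph _).analyticAt_symm' hs.mem_toOpenPartialHomeomorph_source ha he

/-! ### Converse half: flatness and recovery of p. -/

/-- The form `½ (κ ds + ω dt)` with values in the imaginary quaternions. -/
noncomputable def connectionForm (ω κ : ℝ × ℝ → Vec3) (x : ℝ × ℝ) : ℝ × ℝ →L[ℝ] ℍ[ℝ] :=
  (ContinuousLinearMap.fst ℝ ℝ ℝ).smulRight ((1 / 2 : ℝ) • pureQuat (κ x)) +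
    (ContinuousLinearMap.snd ℝ ℝ ℝ).smulRight ((1 / 2 : ℝ) • pureQuat (ω x))

theorem connectionForm_apply (ω κ : ℝ × ℝ → Vec3) (x v : ℝ × ℝ) :
    connectionForm ω κ x v = (1 / 2 : ℝ) • pureQuat (v.1 • κ x + v.2 • ω x) := by
  simp only [connectionForm, add_apply, ContinuousLinearMap.smulRight_apply,
    ContinuousLinearMap.coe_fst', ContinuousLinearMap.coe_snd', map_add, map_smul]
  module

theorem analyticAt_connectionForm {ω κ : ℝ × ℝ → Vec3} {x : ℝ × ℝ} (hω : AnalyticAt ℝ ω x)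
    (hκ : AnalyticAt ℝ κ x) : AnalyticAt ℝ (connectionForm ω κ) x := by
  have h : ∀ (l : ℝ × ℝ →L[ℝ] ℝ) {f : ℝ × ℝ → Vec3}, AnalyticAt ℝ f x →
      AnalyticAt ℝ (fun x => l.smulRight ((1 / 2 : ℝ) • pureQuat (f x))) x := fun l f hf =>
    ((ContinuousLinearMap.smulRightL ℝ (ℝ × ℝ) ℍ[ℝ] l).analyticAt _).fun_comp
      ((((1 / 2 : ℝ) • pureQuat : Vec3 →L[ℝ] ℍ[ℝ]).analyticAt _).fun_comp hf)
  exact (h _ hκ).add (h _ hω)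

theorem fderiv_connectionForm {ω κ : ℝ × ℝ → Vec3} {x : ℝ × ℝ} (hω : AnalyticAt ℝ ω x)
    (hκ : AnalyticAt ℝ κ x) (v w : ℝ × ℝ) :
    fderiv ℝ (connectionForm ω κ) x w v =
      (1 / 2 : ℝ) • pureQuat (v.1 • fderiv ℝ κ x w + v.2 • fderiv ℝ ω x w) := by
  have h1 : HasFDerivAt (fun y => connectionForm ω κ y v)
      ((fderiv ℝ (connectionForm ω κ) x).flip v) x := by
    simpa using (analyticAt_connectionForm hω hκ).differentiableAt.hasFDerivAt.clm_apply
      (hasFDerivAt_const v x)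
  have h2 := ((1 / 2 : ℝ) • pureQuat : Vec3 →L[ℝ] ℍ[ℝ]).hasFDerivAt.comp x
    ((hκ.differentiableAt.hasFDerivAt.const_smul v.1).add
      (hω.differentiableAt.hasFDerivAt.const_smul v.2))
  exact DFunLike.congr_fun (h1.unique (h2.congr_of_eventuallyEq
    (Eventually.of_forall fun y => connectionForm_apply ω κ y v))) w

/-- The kinematic equation says that the connection form is flat. -/
theorem connectionForm_flat {ω κ : ℝ × ℝ → Vec3} {x : ℝ × ℝ} (hω : AnalyticAt ℝ ω x)
    (hκ : AnalyticAt ℝ κ x) (h : FirstKinematicEq ω κ x) (v w : ℝ × ℝ) :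
    fderiv ℝ (connectionForm ω κ) x w v - fderiv ℝ (connectionForm ω κ) x v w =
      connectionForm ω κ x v * connectionForm ω κ x w -
        connectionForm ω κ x w * connectionForm ω κ x v := by
  have hsplit : ∀ (f : ℝ × ℝ → Vec3) (u : ℝ × ℝ),
      fderiv ℝ f x u = u.1 • partialS f x + u.2 • partialT f x := fun f u => by
    rw [partialS, partialT, ← map_smul, ← map_smul, ← map_add]
    simp
  have hc := pureQuat_mul_sub_mul (ω x) (κ x)
  rw [fderiv_connectionForm hω hκ, fderiv_connectionForm hω hκ, hsplit κ, hsplit ω, hsplit κ,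
    hsplit ω, h]
  simp only [connectionForm_apply, map_add, map_sub, map_smul, mul_add,
    add_mul, smul_add, smul_mul_assoc, mul_smul_comm]
  -- Both sides are alternating in v, w, hence multiples of the area form; the quarter is the
  -- product of the two halves in the connection form.
  linear_combination (norm := module) ((v.1 * w.2 - w.1 * v.2) / 4) • hc

theorem exists_rotation_vector {x₀ : ℝ × ℝ} {ω κ : ℝ × ℝ → Vec3} (hω : AnalyticAt ℝ ω x₀)
    (hκ : AnalyticAt ℝ κ x₀) (h : ∀ᶠ x in 𝓝 x₀, FirstKinematicEq ω κ x) {p₀ : Vec3}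
    (h₀ : cosCoeff (len p₀) ≠ 0) :
    ∃ p : ℝ × ℝ → Vec3, AnalyticAt ℝ p x₀ ∧ p x₀ = p₀ ∧
      ∀ᶠ x in 𝓝 x₀, ω x = omegaOf p x ∧ κ x = kappaOf p x := by
  have hflat : ∀ᶠ x in 𝓝 x₀, ∀ v w,
      fderiv ℝ (connectionForm ω κ) x w v - fderiv ℝ (connectionForm ω κ) x v w =
        connectionForm ω κ x v * connectionForm ω κ x w -
          connectionForm ω κ x w * connectionForm ω κ x v := by
    filter_upwards [h, hω.eventually_analyticAt, hκ.eventually_analyticAt] with x hx hωx hκx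
    exact connectionForm_flat hωx hκx hx
  obtain ⟨Y, hY, hY0, hYA⟩ :=
    (analyticAt_connectionForm hω hκ).exists_flat_section hflat (rotor p₀)
  obtain ⟨g, hg, hg0, hge⟩ := exists_analytic_log h₀
  let X : ℝ × ℝ → ℍ[ℝ] := fun x => g (Y x)
  have hX : AnalyticAt ℝ X x₀ := by
    refine AnalyticAt.fun_comp ?_ hY
    rwa [hY0]
  have hXY : ∀ᶠ x in 𝓝 x₀, NormedSpace.exp (X x) = Y x := by
    have : Tendsto Y (𝓝 x₀) (𝓝 (rotor p₀)) := by
      rw [← hY0]; exact hY.continuousAt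
    exact this.eventually hge
  let p : ℝ × ℝ → Vec3 := fun x => ((2 : ℝ) • imVec) (X x)
  have hp : AnalyticAt ℝ p x₀ := (((2 : ℝ) • imVec).analyticAt _).fun_comp hX
  refine ⟨p, hp, ?_, ?_⟩
  · simp [p, X, hY0, hg0]
  filter_upwards [hXY.eventually_nhds, hYA, hX.eventually_analyticAt] with x hx hYx hXx
  have key : ∀ w : ℝ × ℝ, rodrigues (p x) (fderiv ℝ p x w) = w.1 • κ x + w.2 • ω x := by
    intro w
    have hdp : fderiv ℝ p x w = (2 : ℝ) • imVec (fderiv ℝ X x w) := by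
      have := ((2 : ℝ) • imVec).hasFDerivAt.comp x hXx.differentiableAt.hasFDerivAt
      exact DFunLike.congr_fun this.fderiv w
    have hexp : HasFDerivAt (NormedSpace.exp : ℍ[ℝ] → ℍ[ℝ]) (fderiv ℝ NormedSpace.exp (X x)) (X x) :=
      (NormedSpace.exp_analytic (𝕂 := ℝ) (X x)).differentiableAt.hasFDerivAt
    have h1 : HasFDerivAt Y _ x :=
      (hexp.comp x hXx.differentiableAt.hasFDerivAt).congr_of_eventuallyEq
        (hx.mono fun y hy => hy.symm)
    have h2 : NormedSpace.exp (X x) * _ = NormedSpace.exp (X x) * _ :=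
      (fderiv_quaternion_exp (X x) (fderiv ℝ X x w)).symm.trans
        ((DFunLike.congr_fun h1.fderiv w).symm.trans ((hYx w).trans (by rw [← hx.self_of_nhds])))
    -- Comparing imaginary parts discards the contribution of the real part of X, so Y need not be
    -- shown to have norm one.
    have h3 := congrArg imVec (mul_left_cancel₀ (exp_ne_zero _) h2)
    rw [connectionForm_apply, map_add, imVec_coe, zero_add, map_smul, map_smul, imVec_pureQuat,
      imVec_pureQuat] at h3
    rw [hdp]
    exact smul_right_injective Vec3 (by norm_num : (1 / 2 : ℝ) ≠ 0) h3
  exact ⟨by simpa [omegaOf, partialT] using (key (0, 1)).symm,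
    by simpa [kappaOf, partialS] using (key (1, 0)).symm⟩

end Cosserat

theorem proposition1 :
    (∀ (x₀ : ℝ × ℝ) (p : ℝ × ℝ → Cosserat.Vec3), AnalyticAt ℝ p x₀ →
      AnalyticAt ℝ (Cosserat.omegaOf p) x₀ ∧ AnalyticAt ℝ (Cosserat.kappaOf p) x₀ ∧
        ∀ᶠ x in 𝓝 x₀, Cosserat.FirstKinematicEq (Cosserat.omegaOf p) (Cosserat.kappaOf p) x) ∧
    (∀ (x₀ : ℝ × ℝ) (ω κ : ℝ × ℝ → Cosserat.Vec3), AnalyticAt ℝ ω x₀ → AnalyticAt ℝ κ x₀ →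
      (∀ᶠ x in 𝓝 x₀, Cosserat.FirstKinematicEq ω κ x) →
        ∀ p₀ : Cosserat.Vec3, Cosserat.cosCoeff (Cosserat.len p₀) ≠ 0 →
          ∃ p : ℝ × ℝ → Cosserat.Vec3, AnalyticAt ℝ p x₀ ∧ p x₀ = p₀ ∧
            ∀ᶠ x in 𝓝 x₀, ω x = Cosserat.omegaOf p x ∧ κ x = Cosserat.kappaOf p x) := by
  refine ⟨fun x₀ p hp => ⟨Cosserat.analyticAt_rodrigues_fderiv hp _,
    Cosserat.analyticAt_rodrigues_fderiv hp _, ?_⟩, fun x₀ ω κ hω hκ h p₀ h₀ =>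
    Cosserat.exists_rotation_vector hω hκ h h₀⟩
  filter_upwards [hp.eventually_analyticAt] with x hx
  exact Cosserat.firstKinematicEq_of_analyticAt hx
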